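/- Let $n\ge 0$ and let $C_b(\mathbb R^n)$ be the space of bounded continuous functions $f:\mathbb R^n\to\mathbb R$ with the sup norm. A function $f\in C_b(\mathbb R^n)$ is weakly almost periodic if every sequence of translates $(f(\cdot+\lambda_i))_{i\in\mathbb N}$ has a subsequence that converges weakly in the Banach space $C_b(\mathbb R^n)$; let $\mathrm{WAP}(\mathbb R^n)$ be the space of these functions. Let $\mathrm{FS}(\mathbb R^n)$, the Fourier–Stieltjes algebra, be the closure in the sup norm of the set of functions $f:\mathbb R^n\to\mathbb R$ of the form $f(x)=\int_{\mathbb R^n}e^{ix\cdot y}\,d\mu(y)$ with $\mu$ a complex Radon measure on $\mathbb R^n$ of finite total variation. A number $\bar g$ is the mean value of $g\in L^1_{\mathrm{loc}}(\mathbb R^n)$ if $\lim_{\varepsilon\to0^+}\int_A g(\varepsilon^{-1}x)\,dx=|A|\,\bar g$ for every bounded Lebesgue measurable set $A\subset\mathbb R^n$. A linear subspace $\mathcal A$ of the space $\mathrm{BUC}(\mathbb R^n)$ of bounded uniformly continuous real-valued functions is an algebra with mean value if it is closed under products, invariant under translations, closed in the sup norm, contains the constant function $1$, and each of its elements has a mean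 value. Let $\mathcal B^2$ be the completion of $\mathcal A$ with respect to the seminorm $|f|_2=\bigl(\limsup_{L\to\infty}(2L)^{-n}\int_{[-L,L]^n}|f|^2\,dx\bigr)^{1/2}$, to which the translations $T(y)f=f(\cdot+y)$ and the seminorm extend by continuity. The algebra with mean value $\mathcal A$ is ergodic if every $f\in\mathcal B^2$ with $|T(y)f-f|_2=0$ for all $y\in\mathbb R^n$ satisfies $|f-c|_2=0$ for some constant $c\in\mathbb R$. Then $\mathrm{WAP}(\mathbb R^n)$ is an ergodic algebra (in particular, it is an algebra with mean value contained in $\mathrm{BUC}(\mathbb R^n)$), and $\mathrm{FS}(\mathbb R^n)\subset\mathrm{WAP}(\mathbb R^n)$. -/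

import Mathlib

open MeasureTheory Filter Topology BoundedContinuousFunction

noncomputable section

namespace WAPAlgebra

/-- The space `C_b(ℝⁿ)` of bounded continuous real-valued functions, with the sup norm. -/
abbrev Cb (n : ℕ) : Type := EuclideanSpace ℝ (Fin n) →ᵇ ℝ

/-- The translate `f(· + y)` of `f ∈ C_b(ℝⁿ)`. -/
def translate {n : ℕ} (y : EuclideanSpace ℝ (Fin n)) (f : Cb n) : Cb n :=
  f.compContinuous ⟨fun x => x + y, by fun_prop⟩

@[simp]
theorem translate_apply {n : ℕ} (y : EuclideanSpace ℝ (Fin n)) (f : Cb n)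
    (x : EuclideanSpace ℝ (Fin n)) : translate y f x = f (x + y) := rfl

theorem translate_add {n : ℕ} (y : EuclideanSpace ℝ (Fin n)) (f g : Cb n) :
    translate y (f + g) = translate y f + translate y g := rfl

theorem translate_smul {n : ℕ} (y : EuclideanSpace ℝ (Fin n)) (c : ℝ) (f : Cb n) :
    translate y (c • f) = c • translate y f := rfl

/-- `m` is the mean value of `g ∈ L¹_loc(ℝⁿ)`: as `ε → 0`, `ε > 0`,
`∫_A g(x/ε) dx → |A| m` for every bounded Lebesgue measurable set `A`. -/
def HasMeanValue {n : ℕ} (g : EuclideanSpace ℝ (Fin n) → ℝ) (m : ℝ) : Prop :=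
  LocallyIntegrable g volume ∧
    ∀ A : Set (EuclideanSpace ℝ (Fin n)), NullMeasurableSet A volume → Bornology.IsBounded A →
      Tendsto (fun ε : ℝ => ∫ x in A, g (ε⁻¹ • x)) (𝓝[>] 0) (𝓝 (volume.real A * m))

/-- An algebra with mean value: a linear subspace of `BUC(ℝⁿ)` that is stable under products and
translations, all of whose elements have a mean value, and which is closed in the sup norm
and contains the constant function `1`. (`BUC(ℝⁿ)` is closed in `C_b(ℝⁿ)`, so it does not matter
in which of the two spaces the subspace is closed.) -/
structure IsAlgebraWithMeanValue {n : ℕ} (A : Submodule ℝ (Cb n)) : Prop where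
  subset_buc : ∀ f ∈ A, UniformContinuous f
  mul_mem : ∀ f ∈ A, ∀ g ∈ A, f * g ∈ A
  translate_mem : ∀ f ∈ A, ∀ y, translate y f ∈ A
  exists_meanValue : ∀ f ∈ A, ∃ m : ℝ, HasMeanValue f m
  isClosed : IsClosed (A : Set (Cb n))
  one_mem : (1 : Cb n) ∈ A

/-- The Besicovitch seminorm
`|f|₂ = (limsup_{L → ∞} (2L)⁻ⁿ ∫_{[-L,L]ⁿ} |f|² dx)^{1/2}` on `C_b(ℝⁿ)`. -/
def besicovitchSeminorm {n : ℕ} (f : Cb n) : ℝ :=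
  Real.sqrt (limsup (fun L : ℝ =>
    ((2 * L) ^ n)⁻¹ * ∫ x in {x : EuclideanSpace ℝ (Fin n) | ∀ i, x i ∈ Set.Icc (-L) L}, |f x| ^ 2)
    atTop)

/-- The generalized Besicovitch space `𝓑²` of `A`, that is, the abstract completion of `A` for the
seminorm `|·|₂`, as the space of Cauchy sequences of `(A, |·|₂)`. The seminorm of the element
given by `(f_k)` is `lim_k |f_k|₂`, an element `f` of `A` is the constant sequence `f`, and
the algebraic operations and the translations act term by term. -/
structure BesicovitchSpace {n : ℕ} (A : Submodule ℝ (Cb n)) where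
  seq : ℕ → Cb n
  seq_mem : ∀ k, seq k ∈ A
  cauchy : ∀ ε > 0, ∃ N, ∀ j ≥ N, ∀ k ≥ N, besicovitchSeminorm (seq j - seq k) < ε

/-- `F ∈ 𝓑²` is invariant: `|T(y)F - F|₂ = 0` for all `y ∈ ℝⁿ`. -/
def BesicovitchSpace.IsInvariant {n : ℕ} {A : Submodule ℝ (Cb n)} (F : BesicovitchSpace A) :
    Prop :=
  ∀ y, Tendsto (fun k => besicovitchSeminorm (translate y (F.seq k) - F.seq k)) atTop (𝓝 0)

/-- `F ∈ 𝓑²` is equivalent in `𝓑²` to a constant: `|F - c|₂ = 0` for some `c ∈ ℝ`. -/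
def BesicovitchSpace.IsEquivConst {n : ℕ} {A : Submodule ℝ (Cb n)} (F : BesicovitchSpace A) :
    Prop :=
  ∃ c : ℝ, Tendsto (fun k => besicovitchSeminorm (F.seq k - BoundedContinuousFunction.const _ c))
    atTop (𝓝 0)

/-- An ergodic algebra: an algebra with mean value for which every invariant element of `𝓑²` is
equivalent to a constant. -/
structure IsErgodicAlgebra {n : ℕ} (A : Submodule ℝ (Cb n)) : Prop
    extends IsAlgebraWithMeanValue A where
  ergodic : ∀ F : BesicovitchSpace A, F.IsInvariant → F.IsEquivConst

/-- Weak convergence of a sequence in the Banach space `C_b(ℝⁿ)`. -/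
def WeaklyConvergesTo {n : ℕ} (u : ℕ → Cb n) (g : Cb n) : Prop :=
  ∀ Λ : Cb n →L[ℝ] ℝ, Tendsto (fun k => Λ (u k)) atTop (𝓝 (Λ g))

/-- `f ∈ C_b(ℝⁿ)` is weakly almost periodic: every sequence of translates of `f` has a
subsequence that converges weakly in `C_b(ℝⁿ)`. -/
def IsWeaklyAlmostPeriodic {n : ℕ} (f : Cb n) : Prop :=
  ∀ y : ℕ → EuclideanSpace ℝ (Fin n), ∃ φ : ℕ → ℕ, StrictMono φ ∧
    ∃ g : Cb n, WeaklyConvergesTo (fun k => translate (y (φ k)) f) g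

/-- The space `WAP(ℝⁿ)` of weakly almost periodic functions, a subspace of `C_b(ℝⁿ)`. -/
def WAP (n : ℕ) : Submodule ℝ (Cb n) where
  carrier := {f | IsWeaklyAlmostPeriodic f}
  add_mem' := by
    intro f f' hf hf' y
    obtain ⟨φ, hφ, g, hg⟩ := hf y
    obtain ⟨ψ, hψ, g', hg'⟩ := hf' (y ∘ φ)
    refine ⟨φ ∘ ψ, hφ.comp hψ, g + g', fun Λ => ?_⟩
    simp only [translate_add, map_add]
    exact ((hg Λ).comp hψ.tendsto_atTop).add (hg' Λ)
  zero_mem' := fun _ => ⟨id, strictMono_id, 0, fun _ => tendsto_const_nhds⟩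
  smul_mem' := by
    intro c f hf y
    obtain ⟨φ, hφ, g, hg⟩ := hf y
    refine ⟨φ, hφ, c • g, fun Λ => ?_⟩
    simp only [translate_smul, map_smul]
    exact (hg Λ).const_smul c

/-- `f` is the Fourier–Stieltjes transform `f(x) = ∫ e^{i x·y} dμ(y)` of a complex Borel measure
`μ` on `ℝⁿ` of finite total variation (such a measure is automatically Radon). -/
def IsFourierStieltjesTransform {n : ℕ} (f : Cb n) : Prop :=
  ∃ μ : ComplexMeasure (EuclideanSpace ℝ (Fin n)), IsFiniteMeasure μ.variation ∧
    ∀ x, (f x : ℂ) =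
      μ.integral (fun y => Complex.exp (Complex.I * (inner ℝ x y : ℝ)))
        (ContinuousLinearMap.mul ℝ ℂ)

/-- The Fourier–Stieltjes algebra `FS(ℝⁿ)`: the closure, in the sup norm, of the set of
real-valued Fourier–Stieltjes transforms. -/
def FS (n : ℕ) : Set (Cb n) :=
  closure {f | IsFourierStieltjesTransform f}

end WAPAlgebra

end

/-! Weak convergence: `C_b(X)` is `C(K)` for `K` the Stone–Čech compactification of `X`. A
functional on `C(K)` is dominated by its absolute value, a positive functional and so a measure. By
dominated convergence, bounded sequences converge weakly once they converge at each point of `K`.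
Evaluations at these points are multiplicative, which gives stability under products.

Mean value: averages over growing cubes converge, along a sequence, to a translation invariant
functional `L` on the separable closed span `E` of the translates of `f`. For `p` in `K`, the
function `y ↦ p(T(y)f)` is a weak limit `g` of translates of `f`, so `g ∈ E` and `L g = L f`. The
value at `p` of an averaged translate of `f` is a cube average of `g`, and it tends to `L f`. Hence
the averaged translates converge weakly to the constant `c = L f`. By Hahn–Banach, `f - c` lies in
the closed span of the differences `T(y)f - f`, whose averages over any dilated bounded set vanish
in the limit.

Ergodicity: let `M` be an invariant mean. If `M((T(y)f - f)²) ≤ δ` for all `y`, then `M(f · T(y)f) ≥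
M(f²) - δ/2`. Averaging over `y` and passing to the weak limit gives `M(f)² ≥ M(f²) - δ/2`, a bound
on the variance of `f`. This applies to late terms of a Cauchy sequence representing an invariant
element.

Fourier–Stieltjes: the translates of a transform are images of characters under a bounded operator
from `L²(|μ|)`, where bounded sequences have weakly convergent subsequences. As `WAP` is closed, it
contains the closure. -/

open scoped NNReal CompactlySupported symmDiff Pointwise

noncomputable section

namespace WAPAlgebra

/-! ### Functionals on `C(K)` and pointwise convergence. -/

section AbsoluteValue

variable {K : Type*} [TopologicalSpace K]

/-- The values of a functional on the functions dominated by `f`. -/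
def dominatedValues (L : C(K, ℝ) →L[ℝ] ℝ) (f : C_c(K, ℝ≥0)) : Set ℝ :=
  {t | ∃ g : C(K, ℝ), (∀ x, |g x| ≤ f x) ∧ L g = t}

theorem zero_mem_dominatedValues (L : C(K, ℝ) →L[ℝ] ℝ) (f : C_c(K, ℝ≥0)) :
    (0 : ℝ) ∈ dominatedValues L f :=
  ⟨0, fun x => by simp, map_zero L⟩

variable [CompactSpace K]

theorem bddAbove_dominatedValues (L : C(K, ℝ) →L[ℝ] ℝ) (f : C_c(K, ℝ≥0)) :
    BddAbove (dominatedValues L f) := by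
  obtain ⟨C, hC⟩ := (isCompact_range f.continuous).bddAbove
  refine ⟨‖L‖ * C, ?_⟩
  rintro _ ⟨g, hg, rfl⟩
  refine (le_abs_self _).trans ((L.le_opNorm g).trans ?_)
  gcongr
  refine (ContinuousMap.norm_le _ C.2).2 fun x => (hg x).trans ?_
  exact_mod_cast hC ⟨x, rfl⟩

theorem sSup_dominatedValues_nonneg (L : C(K, ℝ) →L[ℝ] ℝ) (f : C_c(K, ℝ≥0)) :
    0 ≤ sSup (dominatedValues L f) :=
  le_csSup (bddAbove_dominatedValues L f) (zero_mem_dominatedValues L f)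

theorem sSup_dominatedValues_add (L : C(K, ℝ) →L[ℝ] ℝ) (f₁ f₂ : C_c(K, ℝ≥0)) :
    sSup (dominatedValues L (f₁ + f₂)) =
      sSup (dominatedValues L f₁) + sSup (dominatedValues L f₂) := by
  apply le_antisymm
  · refine csSup_le ⟨0, zero_mem_dominatedValues _ _⟩ ?_
    rintro _ ⟨g, hg, rfl⟩
    let F : C(K, ℝ) := ⟨fun x => (f₁ x : ℝ), by fun_prop⟩
    -- Riesz decomposition: truncating `g` to `[-f₁, f₁]` leaves a remainder dominated by `f₂`.
    let g₁ : C(K, ℝ) := (g ⊓ F) ⊔ (-F)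
    have h₁ : ∀ x, |g₁ x| ≤ f₁ x := fun x => by
      have : (0 : ℝ) ≤ f₁ x := (f₁ x).2
      change |max (min (g x) (f₁ x)) (-(f₁ x))| ≤ _
      grind
    have h₂ : ∀ x, |(g - g₁) x| ≤ f₂ x := fun x => by
      have h1 : (0 : ℝ) ≤ f₁ x := (f₁ x).2
      have h2 : (0 : ℝ) ≤ f₂ x := (f₂ x).2
      have h3 : |g x| ≤ f₁ x + f₂ x := by simpa using hg x
      change |g x - max (min (g x) (f₁ x)) (-(f₁ x))| ≤ _
      grind
    have : L g = L g₁ + L (g - g₁) := by rw [← map_add]; congr 1; abel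
    rw [this]
    exact add_le_add (le_csSup (bddAbove_dominatedValues L f₁) ⟨g₁, h₁, rfl⟩)
      (le_csSup (bddAbove_dominatedValues L f₂) ⟨g - g₁, h₂, rfl⟩)
  · rw [← csSup_add ⟨0, zero_mem_dominatedValues L f₁⟩ (bddAbove_dominatedValues L f₁)
      ⟨0, zero_mem_dominatedValues L f₂⟩ (bddAbove_dominatedValues L f₂)]
    refine csSup_le_csSup (bddAbove_dominatedValues L _)
      (Set.Nonempty.add ⟨0, zero_mem_dominatedValues L f₁⟩ ⟨0, zero_mem_dominatedValues L f₂⟩) ?_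
    rintro _ ⟨_, ⟨g₁, h₁, rfl⟩, _, ⟨g₂, h₂, rfl⟩, rfl⟩
    refine ⟨g₁ + g₂, fun x => ?_, map_add L _ _⟩
    simpa using (abs_add_le _ _).trans (add_le_add (h₁ x) (h₂ x))

theorem sSup_dominatedValues_smul (L : C(K, ℝ) →L[ℝ] ℝ) (c : ℝ≥0) (f : C_c(K, ℝ≥0)) :
    sSup (dominatedValues L (c • f)) = c * sSup (dominatedValues L f) := by
  -- One inequality suffices: for `c ≠ 0` the reverse is the case of `c⁻¹` and `c • f`.
  have key : ∀ (c : ℝ≥0) (f : C_c(K, ℝ≥0)),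
      c * sSup (dominatedValues L f) ≤ sSup (dominatedValues L (c • f)) := by
    intro c f
    rw [← smul_eq_mul, ← Real.sSup_smul_of_nonneg c.coe_nonneg]
    refine csSup_le_csSup (bddAbove_dominatedValues L _)
      (Set.Nonempty.smul_set ⟨0, zero_mem_dominatedValues L f⟩) ?_
    rintro _ ⟨_, ⟨g, h, rfl⟩, rfl⟩
    refine ⟨(c : ℝ) • g, fun x => ?_, map_smul L _ _⟩
    simpa [abs_mul] using mul_le_mul_of_nonneg_left (h x) c.2
  refine le_antisymm ?_ (key c f)
  rcases eq_or_ne c 0 with rfl | hc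
  · refine csSup_le ⟨0, zero_mem_dominatedValues _ _⟩ ?_
    rintro _ ⟨g, hg, rfl⟩
    have : g = 0 := by ext x; simpa using hg x
    simp [this]
  · have := key c⁻¹ (c • f)
    rw [smul_smul, inv_mul_cancel₀ hc, one_smul] at this
    have h0 : (0 : ℝ) < c := by positivity
    rw [NNReal.coe_inv, inv_mul_le_iff₀ h0] at this
    exact this

/-- The absolute value `|L|` of a functional on `C(K)`, on nonnegative functions. -/
def absFunctional (L : C(K, ℝ) →L[ℝ] ℝ) : C_c(K, ℝ≥0) →ₗ[ℝ≥0] ℝ≥0 where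
  toFun f := ⟨sSup (dominatedValues L f), sSup_dominatedValues_nonneg L f⟩
  map_add' f₁ f₂ := NNReal.eq (sSup_dominatedValues_add L f₁ f₂)
  map_smul' c f := NNReal.eq (sSup_dominatedValues_smul L c f)

/-- A bounded sequence in `C(K)` that converges to zero pointwise converges to zero weakly. -/
theorem tendsto_functional_of_pointwise [T2Space K] (L : C(K, ℝ) →L[ℝ] ℝ) (u : ℕ → C(K, ℝ)) (C : ℝ)
    (hC : ∀ k, ‖u k‖ ≤ C) (hu : ∀ p, Tendsto (fun k => u k p) atTop (𝓝 0)) :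
    Tendsto (fun k => L (u k)) atTop (𝓝 0) := by
  let _ : MeasurableSpace K := borel K
  have : BorelSpace K := ⟨rfl⟩
  set μ : Measure K := NNRealRMK.rieszMeasure (absFunctional L)
  let v : ℕ → C_c(K, ℝ≥0) := fun k =>
    ⟨⟨fun x => ‖u k x‖₊, by fun_prop⟩, HasCompactSupport.of_compactSpace _⟩
  have hle : ∀ k, ‖L (u k)‖ ≤ ∫ x, (v k x : ℝ) ∂μ := by
    intro k
    rw [NNRealRMK.integral_rieszMeasure, Real.norm_eq_abs, abs_le']
    refine ⟨le_csSup (bddAbove_dominatedValues L _) ⟨u k, fun x => le_rfl, rfl⟩,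
      le_csSup (bddAbove_dominatedValues L _) ⟨-u k, fun x => ?_, map_neg L _⟩⟩
    simp [v]
  refine squeeze_zero_norm hle ?_
  have := tendsto_integral_of_dominated_convergence (μ := μ) (F := fun k x => (v k x : ℝ))
    (f := fun _ => (0 : ℝ)) (fun _ => C)
    (fun k => by
      have : Continuous fun x => (v k x : ℝ) := by fun_prop
      exact this.aestronglyMeasurable)
    (integrable_const C)
    (fun k => Eventually.of_forall fun x => by
      simpa [v] using ((u k).norm_coe_le_norm x).trans (hC k))
    (Eventually.of_forall fun x => by
      simpa [v] using (hu x).norm)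
  simpa using this

end AbsoluteValue

/-! ### Weak convergence in `C_b(X)` via the Stone–Čech compactification. -/

section StoneCech

variable {X : Type*} [TopologicalSpace X]

theorem continuous_toClosedBall (f : X →ᵇ ℝ) : Continuous fun x =>
    (⟨f x, by simpa using f.norm_coe_le_norm x⟩ : Metric.closedBall (0 : ℝ) ‖f‖) := by
  fun_prop

/-- The extension of a bounded continuous function to the Stone–Čech compactification. -/
def stoneCechExtension (f : X →ᵇ ℝ) : C(StoneCech X, ℝ) where
  toFun p := (stoneCechExtend (continuous_toClosedBall f) p).1
  continuous_toFun := continuous_subtype_val.comp (continuous_stoneCechExtend _)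

@[simp]
theorem stoneCechExtension_unit (f : X →ᵇ ℝ) (x : X) :
    stoneCechExtension f (stoneCechUnit x) = f x := by
  simp [stoneCechExtension, stoneCechExtend_stoneCechUnit]

theorem stoneCech_ext {F G : C(StoneCech X, ℝ)}
    (h : ∀ x, F (stoneCechUnit x) = G (stoneCechUnit x)) : F = G :=
  DFunLike.coe_injective (stoneCech_hom_ext F.continuous G.continuous (funext h))

theorem norm_stoneCechExtension_le (f : X →ᵇ ℝ) : ‖stoneCechExtension f‖ ≤ ‖f‖ := by
  refine (ContinuousMap.norm_le _ (norm_nonneg f)).2 fun p => ?_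
  exact mem_closedBall_zero_iff.1 (stoneCechExtend (continuous_toClosedBall f) p).2

theorem stoneCechExtension_mul (f g : X →ᵇ ℝ) :
    stoneCechExtension (f * g) = stoneCechExtension f * stoneCechExtension g :=
  stoneCech_ext fun x => by simp

/-- Evaluation at a point of the Stone–Čech compactification. -/
def stoneCechEval (p : StoneCech X) : (X →ᵇ ℝ) →L[ℝ] ℝ :=
  LinearMap.mkContinuous
    { toFun := fun f => stoneCechExtension f p
      map_add' := fun f g => by
        rw [stoneCech_ext (F := stoneCechExtension (f + g))
          (G := stoneCechExtension f + stoneCechExtension g) fun x => by simp]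
        rfl
      map_smul' := fun c f => by
        rw [stoneCech_ext (F := stoneCechExtension (c • f))
          (G := c • stoneCechExtension f) fun x => by simp]
        rfl } 1
    fun f => by
      simpa using ((stoneCechExtension f).norm_coe_le_norm p).trans (norm_stoneCechExtension_le f)

theorem stoneCechEval_apply (p : StoneCech X) (f : X →ᵇ ℝ) :
    stoneCechEval p f = stoneCechExtension f p := rfl

theorem stoneCechEval_mul (p : StoneCech X) (f g : X →ᵇ ℝ) :
    stoneCechEval p (f * g) = stoneCechEval p f * stoneCechEval p g := by
  simp [stoneCechEval_apply, stoneCechExtension_mul]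

/-- A bounded sequence in `C_b(X)` converges weakly if its extensions to the Stone–Čech
compactification converge pointwise. -/
theorem tendsto_of_tendsto_stoneCechEval (L : (X →ᵇ ℝ) →L[ℝ] ℝ) (u : ℕ → X →ᵇ ℝ) (g : X →ᵇ ℝ)
    (C : ℝ) (hC : ∀ k, ‖u k‖ ≤ C)
    (hu : ∀ p, Tendsto (fun k => stoneCechEval p (u k)) atTop (𝓝 (stoneCechEval p g))) :
    Tendsto (fun k => L (u k)) atTop (𝓝 (L g)) := by
  -- Restriction to `X`, a left inverse of the extension; it transports `L` to a functional on
  -- `C(StoneCech X)`.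
  let R : C(StoneCech X, ℝ) →L[ℝ] (X →ᵇ ℝ) := LinearMap.mkContinuous
    { toFun := fun F => (BoundedContinuousFunction.mkOfCompact F).compContinuous
        ⟨stoneCechUnit, continuous_stoneCechUnit⟩
      map_add' := fun _ _ => rfl
      map_smul' := fun _ _ => rfl } 1 fun F => by
    rw [one_mul]
    exact (BoundedContinuousFunction.norm_le (norm_nonneg F)).2 fun x => F.norm_coe_le_norm _
  have hR : ∀ f : X →ᵇ ℝ, R (stoneCechExtension f) = f := fun f => by
    ext x
    exact stoneCechExtension_unit f x
  have := tendsto_functional_of_pointwise (L.comp R) (fun k => stoneCechExtension (u k - g))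
    (C + ‖g‖)
    (fun k => (norm_stoneCechExtension_le _).trans
      ((norm_sub_le _ _).trans (by gcongr; exact hC k)))
    (fun p => by
      have := (hu p).sub_const (stoneCechEval p g)
      rw [sub_self] at this
      refine this.congr fun k => ?_
      rw [← map_sub, stoneCechEval_apply])
  simp only [ContinuousLinearMap.comp_apply, hR, map_sub] at this
  simpa using this.add_const (L g)

end StoneCech

/-! ### Closed subspaces and diagonal subsequences. -/

section ClosedSubmodule

variable {V : Type*} [NormedAddCommGroup V] [NormedSpace ℝ V]

/-- A closed subspace is the intersection of the kernels of the functionals vanishing on it. -/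
theorem mem_of_forall_functional {S : Submodule ℝ V} (hS : IsClosed (S : Set V)) {x : V}
    (h : ∀ L : V →L[ℝ] ℝ, (∀ s ∈ S, L s = 0) → L x = 0) : x ∈ S := by
  by_contra hx
  obtain ⟨L, u, hu, hux⟩ := geometric_hahn_banach_closed_point S.convex hS hx
  have hL : ∀ s ∈ S, L s = 0 := by
    intro s hs
    by_contra hne
    -- This multiple of `s` has `L`-value `u + 1`, above the separating level `u`.
    have := hu (((u + 1) / L s) • s) (S.smul_mem _ hs)
    rw [map_smul, smul_eq_mul, div_mul_cancel₀ _ hne] at this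
    linarith
  have h0 := hu 0 S.zero_mem
  rw [map_zero] at h0
  rw [h L hL] at hux
  linarith

/-- Closed subspaces are weakly sequentially closed. -/
theorem mem_of_tendsto_functional {S : Submodule ℝ V} (hS : IsClosed (S : Set V)) {u : ℕ → V}
    {x : V} (hu : ∀ k, u k ∈ S)
    (h : ∀ L : V →L[ℝ] ℝ, Tendsto (fun k => L (u k)) atTop (𝓝 (L x))) : x ∈ S := by
  refine mem_of_forall_functional hS fun L hL => tendsto_nhds_unique (h L) ?_
  simp [hL _ (hu _)]

end ClosedSubmodule

/-- Successive extraction of subsequences, followed by passing to the diagonal. -/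
theorem exists_diagonal_subsequence {P : ℕ → (ℕ → ℕ) → Prop}
    (h : ∀ m (φ : ℕ → ℕ), StrictMono φ → ∃ ψ : ℕ → ℕ, StrictMono ψ ∧ P m (φ ∘ ψ)) :
    ∃ χ : ℕ → ℕ, StrictMono χ ∧ ∀ m, ∃ φ θ : ℕ → ℕ, P m φ ∧ Tendsto θ atTop atTop ∧
      ∀ᶠ k in atTop, χ k = φ (θ k) := by
  choose! ψ hψ hP using h
  let Φ : ℕ → ℕ → ℕ := fun m => Nat.rec (ψ 0 id) (fun m φ => φ ∘ ψ (m + 1) φ) m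
  have hΦ : ∀ m, Φ (m + 1) = Φ m ∘ ψ (m + 1) (Φ m) := fun m => rfl
  have hmono : ∀ m, StrictMono (Φ m) := by
    intro m
    induction m with
    | zero => exact hψ 0 id strictMono_id
    | succ m ih => rw [hΦ]; exact ih.comp (hψ _ _ ih)
  have hPΦ : ∀ m, P m (Φ m) := by
    rintro (_ | m)
    · exact hP 0 id strictMono_id
    · rw [hΦ]; exact hP _ _ (hmono m)
  have hfac : ∀ m k, ∃ ρ : ℕ → ℕ, StrictMono ρ ∧ Φ (m + k) = Φ m ∘ ρ := by
    intro m k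
    induction k with
    | zero => exact ⟨id, strictMono_id, rfl⟩
    | succ k ih =>
      obtain ⟨ρ, hρ, hk⟩ := ih
      refine ⟨ρ ∘ ψ (m + k + 1) (Φ (m + k)), hρ.comp (hψ _ _ (hmono _)), ?_⟩
      rw [← add_assoc, hΦ, ← Function.comp_assoc, ← hk]
  choose ρ hρ hfac using hfac
  -- For `k ≥ m`, `Φ k = Φ m ∘ ρ m (k - m)`. For `k < m` the subtraction truncates, but `θ k ≥ k`
  -- still holds.
  refine ⟨fun k => Φ k k, strictMono_nat_of_lt_succ fun k => ?_, fun m =>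
    ⟨Φ m, fun k => ρ m (k - m) k, hPΦ m, tendsto_atTop_mono (fun k => (hρ _ _).le_apply) tendsto_id,
      ?_⟩⟩
  · rw [hΦ]
    exact hmono k ((Nat.lt_succ_self k).trans_le (hψ _ _ (hmono k)).le_apply)
  · filter_upwards [eventually_ge_atTop m] with k hk
    have := congrFun (hfac m (k - m)) k
    rwa [Nat.add_sub_cancel' hk] at this

/-! ### Stability properties of weakly almost periodic functions. -/

variable {n : ℕ}

theorem translate_translate (y z : EuclideanSpace ℝ (Fin n)) (f : Cb n) :
    translate y (translate z f) = translate (y + z) f := by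
  ext x
  simp [add_assoc]

@[simp]
theorem translate_zero (f : Cb n) : translate 0 f = f := by
  ext x
  simp

theorem translate_mul (y : EuclideanSpace ℝ (Fin n)) (f g : Cb n) :
    translate y (f * g) = translate y f * translate y g := rfl

theorem translate_sub (y : EuclideanSpace ℝ (Fin n)) (f g : Cb n) :
    translate y (f - g) = translate y f - translate y g := rfl

theorem norm_translate_le (y : EuclideanSpace ℝ (Fin n)) (f : Cb n) : ‖translate y f‖ ≤ ‖f‖ :=
  (norm_le (norm_nonneg f)).2 fun _ => f.norm_coe_le_norm _

theorem WeaklyConvergesTo.tendsto_apply {u : ℕ → Cb n} {g : Cb n} (h : WeaklyConvergesTo u g)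
    (x : EuclideanSpace ℝ (Fin n)) : Tendsto (fun k => u k x) atTop (𝓝 (g x)) :=
  h (evalCLM ℝ x)

/-- The pointwise limit on a dense set identifies the weak limit of a subsequence of translates. -/
theorem IsWeaklyAlmostPeriodic.exists_subseq {f : Cb n} (hf : IsWeaklyAlmostPeriodic f)
    {q : ℕ → EuclideanSpace ℝ (Fin n)} (hq : DenseRange q) (y : ℕ → EuclideanSpace ℝ (Fin n))
    {h : EuclideanSpace ℝ (Fin n) → ℝ} (hc : Continuous h)
    (hh : ∀ j, Tendsto (fun k => f (q j + y k)) atTop (𝓝 (h (q j)))) :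
    ∃ φ : ℕ → ℕ, StrictMono φ ∧ ∃ g : Cb n, ⇑g = h ∧
      WeaklyConvergesTo (fun k => translate (y (φ k)) f) g := by
  obtain ⟨φ, hφ, g, hg⟩ := hf y
  refine ⟨φ, hφ, g, hq.equalizer g.continuous hc (funext fun j => ?_), hg⟩
  exact tendsto_nhds_unique (hg.tendsto_apply (q j)) ((hh j).comp hφ.tendsto_atTop)

/-- If `z k → y` in a countable dense set, some subsequence of the translates by `z k` converges
weakly to the translate by `y`. The closed span of countably many translates is weakly sequentially
closed, so it contains the orbit. -/
theorem IsWeaklyAlmostPeriodic.isSeparable_orbit {f : Cb n} (hf : IsWeaklyAlmostPeriodic f) :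
    TopologicalSpace.IsSeparable (Set.range fun y => translate y f) := by
  let q := TopologicalSpace.denseSeq (EuclideanSpace ℝ (Fin n))
  have hq : DenseRange q := TopologicalSpace.denseRange_denseSeq _
  let S := Submodule.span ℝ (Set.range fun i => translate (q i) f)
  have hS : TopologicalSpace.IsSeparable (S.topologicalClosure : Set (Cb n)) := by
    rw [Submodule.topologicalClosure_coe]
    exact (Set.countable_range _).isSeparable.span.closure
  refine hS.mono ?_
  rintro _ ⟨y, rfl⟩
  obtain ⟨z, hz, hzy⟩ := mem_closure_iff_seq_limit.1 (hq y)
  obtain ⟨φ, -, g, hg, hφg⟩ := hf.exists_subseq hq z (translate y f).continuous fun j =>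
    (f.continuous.tendsto _).comp (hzy.const_add (q j))
  obtain rfl : g = translate y f := DFunLike.coe_injective hg
  refine mem_of_tendsto_functional S.isClosed_topologicalClosure (fun k => ?_) hφg
  obtain ⟨i, hi⟩ := hz (φ k)
  exact S.le_topologicalClosure (Submodule.subset_span ⟨i, by simp only [hi]⟩)

/-- Weakly almost periodic functions are uniformly continuous. -/
theorem IsWeaklyAlmostPeriodic.uniformContinuous {f : Cb n} (hf : IsWeaklyAlmostPeriodic f) :
    UniformContinuous f := by
  obtain ⟨c, hc, hfc⟩ := hf.isSeparable_orbit
  rw [Metric.uniformContinuous_iff]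
  intro ε hε
  have := hc.to_subtype
  -- Baire: these countably many closed sets cover the space, so one has an interior point `h₀`. For
  -- `a - b` small, the translates by `h₀` and `h₀ + (a - b)` are both close to `d`; evaluation at
  -- `b - h₀` compares `f b` with `f a`.
  let F : c → Set (EuclideanSpace ℝ (Fin n)) := fun d => {h | dist (translate h f) d ≤ ε / 3}
  have hF : ∀ d, IsClosed (F d) := by
    intro d
    have : F d = ⋂ x, {h | dist (f (x + h)) ((d : Cb n) x) ≤ ε / 3} := by
      ext h
      simp [F, dist_le (show 0 ≤ ε / 3 by positivity)]
    rw [this]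
    exact isClosed_iInter fun x => isClosed_le (by fun_prop) continuous_const
  have hU : ⋃ d, F d = Set.univ := by
    refine Set.eq_univ_of_forall fun h => ?_
    obtain ⟨d, hd, hdist⟩ := Metric.mem_closure_iff.1 (hfc ⟨h, rfl⟩) (ε / 3) (by positivity)
    exact Set.mem_iUnion.2 ⟨⟨d, hd⟩, hdist.le⟩
  obtain ⟨d, h₀, hh₀⟩ := nonempty_interior_of_iUnion_of_closed hF hU
  obtain ⟨r, hr, hball⟩ := Metric.isOpen_iff.1 isOpen_interior h₀ hh₀
  refine ⟨r, hr, fun {a b} hab => ?_⟩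
  have h1 : h₀ + (a - b) ∈ F d := interior_subset (hball (by simpa [dist_eq_norm] using hab))
  have h2 : h₀ ∈ F d := interior_subset hh₀
  have h3 := (dist_coe_le_dist (b - h₀)).trans h1
  have h4 := (dist_coe_le_dist (b - h₀)).trans h2
  simp only [translate_apply, sub_add_cancel] at h4
  rw [translate_apply, show b - h₀ + (h₀ + (a - b)) = a by abel] at h3
  have := dist_triangle_right (f a) (f b) ((d : Cb n) (b - h₀))
  linarith

theorem continuous_translate {f : Cb n} (hf : UniformContinuous f) :
    Continuous fun y => translate y f := by
  rw [Metric.continuous_iff]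
  intro y ε hε
  obtain ⟨δ, hδ, h⟩ := Metric.uniformContinuous_iff.1 hf (ε / 2) (by positivity)
  refine ⟨δ, hδ, fun z hz => lt_of_le_of_lt ?_ (half_lt_self hε)⟩
  exact (dist_le (by positivity)).2 fun x => (h (by simpa using hz)).le

theorem IsWeaklyAlmostPeriodic.translate {f : Cb n} (hf : IsWeaklyAlmostPeriodic f)
    (z : EuclideanSpace ℝ (Fin n)) :
    IsWeaklyAlmostPeriodic (translate z f) := by
  intro y
  simpa only [translate_translate] using hf fun k => y k + z

/-- Evaluations at Stone–Čech points are multiplicative and suffice to test weak convergence of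
bounded sequences. -/
theorem IsWeaklyAlmostPeriodic.mul {f f' : Cb n} (hf : IsWeaklyAlmostPeriodic f)
    (hf' : IsWeaklyAlmostPeriodic f') : IsWeaklyAlmostPeriodic (f * f') := by
  intro y
  obtain ⟨φ, hφ, g, hg⟩ := hf y
  obtain ⟨ψ, hψ, g', hg'⟩ := hf' (y ∘ φ)
  refine ⟨φ ∘ ψ, hφ.comp hψ, g * g', fun Λ => ?_⟩
  refine tendsto_of_tendsto_stoneCechEval Λ _ _ ‖f * f'‖
    (fun k => norm_translate_le _ _) fun p => ?_
  simp only [translate_mul, stoneCechEval_mul]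
  exact ((hg _).comp hψ.tendsto_atTop).mul (hg' _)

theorem isWeaklyAlmostPeriodic_const (c : ℝ) :
    IsWeaklyAlmostPeriodic (BoundedContinuousFunction.const (EuclideanSpace ℝ (Fin n)) c) :=
  fun _ => ⟨id, strictMono_id, .const _ c, fun _ => tendsto_const_nhds⟩

theorem isClosed_WAP : IsClosed (WAP n : Set (Cb n)) := by
  refine isClosed_of_closure_subset fun f hf y => ?_
  obtain ⟨F, hF, hFf⟩ := mem_closure_iff_seq_limit.1 hf
  obtain ⟨χ, hχ, h⟩ := exists_diagonal_subsequence
    (P := fun m φ => ∃ g, WeaklyConvergesTo (fun k => translate (y (φ k)) (F m)) g)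
    fun m φ _ => by simpa only [Function.comp_apply] using hF m (y ∘ φ)
  have h' : ∀ m, ∃ g, WeaklyConvergesTo (fun k => translate (y (χ k)) (F m)) g := by
    intro m
    obtain ⟨φ, θ, ⟨g, hg⟩, hθ, heq⟩ := h m
    refine ⟨g, fun Λ => ((hg Λ).comp hθ).congr' ?_⟩
    filter_upwards [heq] with k hk
    simp [hk]
  choose G hG using h'
  have hdist : ∀ m l, dist (G m) (G l) ≤ dist (F m) (F l) := fun m l =>
    (dist_le dist_nonneg).2 fun x =>
      le_of_tendsto (((hG m).tendsto_apply x).dist ((hG l).tendsto_apply x))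
        (Eventually.of_forall fun k =>
          dist_coe_le_dist (f := F m) (g := F l) (x + y (χ k)))
  have hcauchy : CauchySeq G := by
    rw [Metric.cauchySeq_iff]
    intro ε hε
    obtain ⟨N, hN⟩ := Metric.cauchySeq_iff.1 hFf.cauchySeq ε hε
    exact ⟨N, fun m hm l hl => (hdist m l).trans_lt (hN m hm l hl)⟩
  obtain ⟨g, hg⟩ := cauchySeq_tendsto_of_complete hcauchy
  refine ⟨χ, hχ, g, fun Λ => ?_⟩
  -- Interchange of the limits in `m` and `k`: the error `‖Λ‖ * ‖f - F m‖` does not depend on `k`.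
  refine TendstoUniformlyOnFilter.tendsto_of_eventually_tendsto
    (F := fun m k => Λ (translate (y (χ k)) (F m))) (p := atTop) (L := fun m => Λ (G m)) ?_
    (Eventually.of_forall fun m => hG m Λ) ((Λ.continuous.tendsto g).comp hg)
  rw [Metric.tendstoUniformlyOnFilter_iff]
  intro ε hε
  have h1 : Tendsto (fun m => ‖Λ‖ * ‖f - F m‖) atTop (𝓝 0) := by
    simpa using ((tendsto_const_nhds (x := f)).sub hFf).norm.const_mul ‖Λ‖
  refine ((h1.eventually_lt_const hε).prod_mk (eventually_true atTop)).mono ?_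
  rintro ⟨m, k⟩ ⟨hm, -⟩
  rw [dist_eq_norm, ← map_sub, ← translate_sub]
  refine (Λ.le_opNorm _).trans_lt (lt_of_le_of_lt ?_ hm)
  gcongr
  exact norm_translate_le _ _

/-! ### Averages over dilated sets. -/

theorem norm_setIntegral_sub_setIntegral_le {X : Type*} [MeasurableSpace X] {μ : Measure X}
    {s t : Set X} (hs : NullMeasurableSet s μ) (ht : NullMeasurableSet t μ) (hs' : μ s ≠ ⊤)
    (ht' : μ t ≠ ⊤) {f : X → ℝ} (hf : AEStronglyMeasurable f μ) {C : ℝ} (hC : ∀ x, ‖f x‖ ≤ C) :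
    ‖(∫ x in s, f x ∂μ) - ∫ x in t, f x ∂μ‖ ≤ C * μ.real (s ∆ t) := by
  have hint : ∀ {r : Set X}, μ r ≠ ⊤ → IntegrableOn f r μ := fun hr =>
    Measure.integrableOn_of_bounded hr hf (Eventually.of_forall hC)
  have h1 := integral_inter_add_sdiff₀ ht (hint hs')
  have h2 := integral_inter_add_sdiff₀ hs (hint ht')
  rw [Set.inter_comm] at h2
  have hst : μ (s \ t) < ⊤ := (measure_mono Set.sdiff_subset).trans_lt hs'.lt_top
  have hts : μ (t \ s) < ⊤ := (measure_mono Set.sdiff_subset).trans_lt ht'.lt_top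
  have h3 := norm_setIntegral_le_of_norm_le_const (f := f) hst fun x _ => hC x
  have h4 := norm_setIntegral_le_of_norm_le_const (f := f) hts fun x _ => hC x
  have h5 : μ.real (s ∆ t) = μ.real (s \ t) + μ.real (t \ s) := by
    rw [measureReal_def, measure_symmDiff_eq hs ht, ENNReal.toReal_add hst.ne hts.ne]
    rfl
  rw [h5, mul_add, ← h1, ← h2, add_sub_add_left_eq_sub]
  exact (norm_sub_le _ _).trans (add_le_add h3 h4)

section ScaledIntegral

variable (ν : Measure (EuclideanSpace ℝ (Fin n))) [IsFiniteMeasure ν]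

/-- The functional `f ↦ ∫ f(x/ε) dν(x)`. -/
def scaledIntegral (ε : ℝ) : Cb n →L[ℝ] ℝ :=
  LinearMap.mkContinuous
    { toFun := fun f => ∫ x, f (ε⁻¹ • x) ∂ν
      map_add' := fun f g => integral_add
        ((f.compContinuous ⟨fun x => ε⁻¹ • x, by fun_prop⟩).integrable ν)
        ((g.compContinuous ⟨fun x => ε⁻¹ • x, by fun_prop⟩).integrable ν)
      map_smul' := fun c f => integral_const_mul c _ } (ν.real Set.univ)
    fun f => by
      rw [mul_comm]
      exact norm_integral_le_of_norm_le_const (Eventually.of_forall fun x => f.norm_coe_le_norm _)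

theorem scaledIntegral_apply (ε : ℝ) (f : Cb n) :
    scaledIntegral ν ε f = ∫ x, f (ε⁻¹ • x) ∂ν := rfl

theorem norm_scaledIntegral_le (ε : ℝ) : ‖scaledIntegral ν ε‖ ≤ ν.real Set.univ :=
  LinearMap.mkContinuous_norm_le _ measureReal_nonneg _

end ScaledIntegral

theorem isFiniteMeasure_restrict_of_isBounded {A : Set (EuclideanSpace ℝ (Fin n))}
    (hA : Bornology.IsBounded A) : IsFiniteMeasure (volume.restrict A) :=
  isFiniteMeasure_restrict.2 hA.measure_lt_top.ne

/-- Averages over large sets are asymptotically invariant under translations. -/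
theorem tendsto_setIntegral_translate_sub {A : Set (EuclideanSpace ℝ (Fin n))}
    (hA : NullMeasurableSet A volume) (hb : Bornology.IsBounded A) (f : Cb n)
    (y : EuclideanSpace ℝ (Fin n)) :
    Tendsto (fun ε : ℝ => (∫ x in A, translate y f (ε⁻¹ • x)) - ∫ x in A, f (ε⁻¹ • x))
      (𝓝[>] 0) (𝓝 0) := by
  -- Translating `f` by `y` amounts to shifting `A` by `ε y`, and the symmetric difference of `A`
  -- with its shift has measure tending to zero.
  let T : ℝ → C(EuclideanSpace ℝ (Fin n), EuclideanSpace ℝ (Fin n)) := fun ε =>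
    ⟨fun x => x + (-ε) • y, by fun_prop⟩
  have hT : Continuous T :=
    (ContinuousMap.curry ⟨fun p : ℝ × EuclideanSpace ℝ (Fin n) => p.2 + (-p.1) • y,
      by fun_prop⟩).continuous
  have hmp : ∀ ε, MeasurePreserving (T ε) volume volume := fun ε =>
    measurePreserving_add_right volume _
  have hT0 : ⇑(T 0) = id := by
    ext1 x
    simp [T]
  have hlim := tendsto_measure_symmDiff_preimage_nhds_zero ((hT.tendsto 0).mono_left
    (nhdsWithin_le_nhds (s := Set.Ioi 0))) (Eventually.of_forall hmp) (hmp 0) hA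
    hb.measure_lt_top.ne
  rw [hT0, Set.preimage_id] at hlim
  have hlim' : Tendsto (fun ε => ‖f‖ * volume.real ((T ε ⁻¹' A) ∆ A)) (𝓝[>] 0) (𝓝 0) := by
    simpa [Measure.real] using
      ((ENNReal.tendsto_toReal ENNReal.zero_ne_top).comp hlim).const_mul ‖f‖
  refine squeeze_zero_norm' ?_ hlim'
  filter_upwards [self_mem_nhdsWithin] with ε hε
  have hε' : ε ≠ 0 := (Set.mem_Ioi.1 hε).ne'
  have hshift : ∫ x in A, translate y f (ε⁻¹ • x) = ∫ x in T ε ⁻¹' A, f (ε⁻¹ • x) := by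
    have hemb : MeasurableEmbedding (T ε) :=
      (MeasurableEquiv.addRight ((-ε) • y)).measurableEmbedding
    rw [← (hmp ε).setIntegral_preimage_emb hemb]
    refine integral_congr_ae (Eventually.of_forall fun x => ?_)
    simp [T, smul_smul, hε']
  rw [hshift]
  refine norm_setIntegral_sub_setIntegral_le
    (hA.preimage (hmp ε).quasiMeasurePreserving) hA ?_ hb.measure_lt_top.ne
    (Continuous.aestronglyMeasurable (by fun_prop)) fun x => f.norm_coe_le_norm _
  rw [(hmp ε).measure_preimage hA]
  exact hb.measure_lt_top.ne

/-- The cube `[-1,1]ⁿ`. -/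
def cube (n : ℕ) : Set (EuclideanSpace ℝ (Fin n)) := {x | ∀ i, x i ∈ Set.Icc (-1) 1}

theorem cube_eq_preimage (n : ℕ) :
    cube n =
    (MeasurableEquiv.toLp 2 (Fin n → ℝ)).symm ⁻¹' Set.Icc (fun _ => -1) fun _ => 1 := by
  ext x
  simp [cube, Set.mem_Icc, Pi.le_def, forall_and]

theorem volume_real_cube (n : ℕ) : volume.real (cube n) = 2 ^ n := by
  rw [cube_eq_preimage, measureReal_def,
    (EuclideanSpace.volume_preserving_symm_measurableEquiv_toLp (Fin n)).measure_preimage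
      measurableSet_Icc.nullMeasurableSet, Real.volume_Icc_pi_toReal (fun _ => by norm_num)]
  norm_num

theorem isClosed_cube (n : ℕ) : IsClosed (cube n) := by
  have : cube n = ⋂ i, {x | x i ∈ Set.Icc (-1) 1} := by
    ext x
    simp [cube]
  rw [this]
  exact isClosed_iInter fun i => isClosed_Icc.preimage (by fun_prop)

theorem isBounded_cube (n : ℕ) : Bornology.IsBounded (cube n) := by
  have h : Bornology.IsBounded (Set.Icc (fun _ : Fin n => (-1 : ℝ)) fun _ => 1) :=
    Metric.isBounded_Icc _ _
  rw [cube_eq_preimage]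
  exact (PiLp.antilipschitzWith_ofLp 2 (fun _ : Fin n => ℝ)).isBounded_preimage h

instance (n : ℕ) : IsFiniteMeasure (volume.restrict (cube n)) :=
  isFiniteMeasure_restrict_of_isBounded (isBounded_cube n)

/-- The average of `f(x/ε)` over the cube `[-1,1]ⁿ`. -/
def cubeAverage (n : ℕ) (ε : ℝ) : Cb n →L[ℝ] ℝ :=
  ((2 : ℝ) ^ n)⁻¹ • scaledIntegral (volume.restrict (cube n)) ε

theorem cubeAverage_apply (ε : ℝ) (f : Cb n) :
    cubeAverage n ε f = ((2 : ℝ) ^ n)⁻¹ * ∫ x in cube n, f (ε⁻¹ • x) := rfl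

theorem norm_cubeAverage_le (ε : ℝ) : ‖cubeAverage n ε‖ ≤ 1 := by
  refine (ContinuousLinearMap.opNorm_smul_le _ _).trans ?_
  rw [norm_inv, norm_pow, Real.norm_ofNat]
  refine (mul_le_mul_of_nonneg_left (norm_scaledIntegral_le _ ε) (by positivity)).trans_eq ?_
  rw [measureReal_restrict_apply_univ, volume_real_cube, inv_mul_cancel₀ (by positivity)]

theorem cubeAverage_const (ε c : ℝ) :
    cubeAverage n ε (BoundedContinuousFunction.const _ c) = c := by
  simp [cubeAverage_apply, volume_real_cube]

theorem tendsto_cubeAverage_translate_sub (f : Cb n) (y : EuclideanSpace ℝ (Fin n)) :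
    Tendsto (fun ε => cubeAverage n ε (translate y f) - cubeAverage n ε f) (𝓝[>] 0) (𝓝 0) := by
  simpa [cubeAverage_apply, mul_sub] using (tendsto_setIntegral_translate_sub
    (isClosed_cube n).measurableSet.nullMeasurableSet (isBounded_cube n) f y).const_mul
      ((2 : ℝ) ^ n)⁻¹

/-- The average of the translates `f(· + x/ε)` over `x ∈ [-1,1]ⁿ`. -/
def averagedTranslate (ε : ℝ) (f : Cb n) : Cb n :=
  ((2 : ℝ) ^ n)⁻¹ • ∫ x in cube n, translate (ε⁻¹ • x) f

theorem map_averagedTranslate {f : Cb n} (hf : UniformContinuous f) (L : Cb n →L[ℝ] ℝ) (ε : ℝ) :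
    L (averagedTranslate ε f) = ((2 : ℝ) ^ n)⁻¹ * ∫ x in cube n, L (translate (ε⁻¹ • x) f) := by
  rw [averagedTranslate, map_smul, smul_eq_mul, ← L.integral_comp_comm]
  have hc : Continuous fun x : EuclideanSpace ℝ (Fin n) => translate (ε⁻¹ • x) f :=
    (continuous_translate hf).comp (by fun_prop)
  exact hc.continuousOn.integrableOn_compact
    (Metric.isCompact_of_isClosed_isBounded (isClosed_cube n) (isBounded_cube n))

theorem norm_averagedTranslate_le (ε : ℝ) (f : Cb n) : ‖averagedTranslate ε f‖ ≤ ‖f‖ := by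
  rw [averagedTranslate, norm_smul, norm_inv, norm_pow, Real.norm_ofNat,
    inv_mul_le_iff₀ (by positivity), mul_comm, ← volume_real_cube]
  exact norm_setIntegral_le_of_norm_le_const (isBounded_cube n).measure_lt_top fun x _ =>
    norm_translate_le _ _

/-! ### Weak convergence of averages and existence of the mean value. -/

/-- Sequential Banach–Alaoglu on a separable subspace, with the limit extended by Hahn–Banach. -/
theorem exists_subseq_tendsto_functional {V : Type*} [NormedAddCommGroup V] [NormedSpace ℝ V]
    {E : Submodule ℝ V} (hE : TopologicalSpace.IsSeparable (E : Set V)) (α : ℕ → V →L[ℝ] ℝ)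
    {C : ℝ} (hC : 0 ≤ C) (hα : ∀ k v, ‖α k v‖ ≤ C * ‖v‖) :
    ∃ (φ : ℕ → ℕ) (L : V →L[ℝ] ℝ), StrictMono φ ∧
      ∀ v ∈ E, Tendsto (fun k => α (φ k) v) atTop (𝓝 (L v)) := by
  have : TopologicalSpace.SeparableSpace E := hE.separableSpace
  have hmem : ∀ k, StrongDual.toWeakDual ((α k).comp E.subtypeL) ∈
      WeakDual.toStrongDual ⁻¹' Metric.closedBall (0 : StrongDual ℝ E) C := by
    intro k
    have : ‖(α k).comp E.subtypeL‖ ≤ C :=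
      ContinuousLinearMap.opNorm_le_bound _ hC fun v => hα k v
    exact (mem_closedBall_zero_iff (E := StrongDual ℝ E)).2 this
  obtain ⟨Λ, -, φ, hφ, hΛ⟩ := WeakDual.isSeqCompact_closedBall ℝ E 0 C hmem
  obtain ⟨L, hL, -⟩ := exists_extension_norm_eq E (WeakDual.toStrongDual Λ)
  refine ⟨φ, L, hφ, fun v hv => ?_⟩
  rw [show L v = Λ ⟨v, hv⟩ from hL ⟨v, hv⟩]
  exact ((WeakDual.eval_continuous (⟨v, hv⟩ : E)).tendsto Λ).comp hΛ

/-- Evaluating the translates of `f` at a point of the Stone–Čech compactification gives a weak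
limit of translates of `f`. -/
theorem IsWeaklyAlmostPeriodic.exists_limit_stoneCechEval {f : Cb n}
    (hf : IsWeaklyAlmostPeriodic f) (p : StoneCech (EuclideanSpace ℝ (Fin n))) :
    ∃ (g : Cb n) (x : ℕ → EuclideanSpace ℝ (Fin n)),
      (∀ y, stoneCechEval p (WAPAlgebra.translate y f) = g y) ∧
        WeaklyConvergesTo (fun k => WAPAlgebra.translate (x k) f) g := by
  let q := TopologicalSpace.denseSeq (EuclideanSpace ℝ (Fin n))
  have hq : DenseRange q := TopologicalSpace.denseRange_denseSeq _
  let h : EuclideanSpace ℝ (Fin n) → ℝ := fun y => stoneCechEval p (WAPAlgebra.translate y f)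
  have hc : Continuous h := (stoneCechEval p).continuous.comp
    (continuous_translate hf.uniformContinuous)
  -- By density of the space in its compactification, a genuine point imitates `p` on the first `k`
  -- translates up to `1 / (k + 1)`.
  have hx : ∀ k : ℕ, ∃ x : EuclideanSpace ℝ (Fin n), ∀ j < k,
      dist (f (q j + x)) (h (q j)) < 1 / ((k : ℝ) + 1) := by
    intro k
    let U : Set (StoneCech (EuclideanSpace ℝ (Fin n))) := ⋂ j ∈ Finset.range k,
      {p' | dist (stoneCechExtension (WAPAlgebra.translate (q j) f) p') (h (q j))
        < 1 / ((k : ℝ) + 1)}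
    have hU : IsOpen U := isOpen_biInter_finset fun j _ =>
      isOpen_lt (by fun_prop) continuous_const
    have hp : p ∈ U := by
      simp only [U, Set.mem_iInter]
      intro j _
      change dist (h (q j)) (h (q j)) < _
      rw [dist_self]
      positivity
    obtain ⟨x, hx⟩ := denseRange_stoneCechUnit.exists_mem_open hU ⟨p, hp⟩
    refine ⟨x, fun j hj => ?_⟩
    have := Set.mem_iInter₂.1 hx j (Finset.mem_range.2 hj)
    simpa [add_comm] using this
  choose x hx using hx
  obtain ⟨φ, -, g, hg, hφg⟩ := hf.exists_subseq hq x hc fun j => by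
    rw [tendsto_iff_dist_tendsto_zero]
    refine squeeze_zero' (Eventually.of_forall fun _ => dist_nonneg) ?_
      tendsto_one_div_add_atTop_nhds_zero_nat
    filter_upwards [eventually_gt_atTop j] with k hk using (hx k j hk).le
  exact ⟨g, x ∘ φ, fun y => (congrFun hg y).symm, hφg⟩

theorem tendsto_one_div_add_atTop_nhdsGT_zero_nat :
    Tendsto (fun k : ℕ => 1 / ((k : ℝ) + 1)) atTop (𝓝[>] 0) :=
  tendsto_nhdsWithin_iff.2 ⟨tendsto_one_div_add_atTop_nhds_zero_nat,
    Eventually.of_forall fun k => Set.mem_Ioi.2 (by positivity)⟩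

/-- A sequence of averages of the translates of a weakly almost periodic function converges weakly
to a constant. -/
theorem IsWeaklyAlmostPeriodic.exists_weaklyConvergesTo_const {f : Cb n}
    (hf : IsWeaklyAlmostPeriodic f) : ∃ (c : ℝ) (ε : ℕ → ℝ),
      WeaklyConvergesTo (fun k => averagedTranslate (ε k) f)
        (BoundedContinuousFunction.const _ c) := by
  let E : Submodule ℝ (Cb n) :=
    (Submodule.span ℝ (Set.range fun y => WAPAlgebra.translate y f)).topologicalClosure
  have hE : IsClosed (E : Set (Cb n)) := Submodule.isClosed_topologicalClosure _
  have hsep : TopologicalSpace.IsSeparable (E : Set (Cb n)) := by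
    rw [Submodule.topologicalClosure_coe]
    exact hf.isSeparable_orbit.span.closure
  have hmem : ∀ y, WAPAlgebra.translate y f ∈ E := fun y =>
    Submodule.le_topologicalClosure _ (Submodule.subset_span ⟨y, rfl⟩)
  let δ : ℕ → ℝ := fun k => 1 / ((k : ℝ) + 1)
  obtain ⟨φ, L, hφ, hlim⟩ := exists_subseq_tendsto_functional hsep
    (fun k => cubeAverage n (δ k)) zero_le_one
    fun k g => (cubeAverage n (δ k)).le_of_opNorm_le (norm_cubeAverage_le _) g
  have hf0 : f ∈ E := by simpa using hmem 0
  have hinv : ∀ y, L (WAPAlgebra.translate y f) = L f := by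
    intro y
    have h := (hlim _ (hmem y)).sub (hlim f hf0)
    have h' := (tendsto_cubeAverage_translate_sub f y).comp
      (tendsto_one_div_add_atTop_nhdsGT_zero_nat.comp hφ.tendsto_atTop)
    exact sub_eq_zero.1 (tendsto_nhds_unique h h')
  refine ⟨L f, fun k => δ (φ k), fun L' => ?_⟩
  refine tendsto_of_tendsto_stoneCechEval L' _ _ ‖f‖
    (fun k => norm_averagedTranslate_le _ _) fun p => ?_
  obtain ⟨g, x, hg, hx⟩ := hf.exists_limit_stoneCechEval p
  -- Membership in `E` is essential: the cube averages are known to converge to `L` only there.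
  have hgE : g ∈ E := mem_of_tendsto_functional hE (fun k => hmem (x k)) hx
  have hLg : L g = L f := by
    have h2 := hx L
    simp only [hinv] at h2
    exact (tendsto_nhds_unique tendsto_const_nhds h2).symm
  have hconst : stoneCechEval p (BoundedContinuousFunction.const (EuclideanSpace ℝ (Fin n))
      (L f)) = L f := by
    rw [stoneCechEval_apply, stoneCech_ext (F := stoneCechExtension _)
      (G := ContinuousMap.const _ (L f)) fun x => by simp]
    rfl
  rw [hconst, ← hLg]
  refine (hlim g hgE).congr fun k => ?_
  rw [map_averagedTranslate hf.uniformContinuous, cubeAverage_apply]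
  simp only [hg]

/-- The closed span of the differences of `f` and its translates. -/
def translateDifferences (f : Cb n) : Submodule ℝ (Cb n) :=
  (Submodule.span ℝ (Set.range fun y => translate y f - f)).topologicalClosure

/-- A functional `L` vanishing on the differences takes the value `L f` at every averaged translate,
hence also at their weak limit, the constant `c`. -/
theorem IsWeaklyAlmostPeriodic.exists_sub_const_mem {f : Cb n} (hf : IsWeaklyAlmostPeriodic f) :
    ∃ c : ℝ, f - BoundedContinuousFunction.const _ c ∈ translateDifferences f := by
  obtain ⟨c, ε, h⟩ := hf.exists_weaklyConvergesTo_const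
  refine ⟨c, mem_of_forall_functional (Submodule.isClosed_topologicalClosure _) fun L hL => ?_⟩
  have hinv : ∀ y, L (WAPAlgebra.translate y f) = L f := fun y => by
    rw [← sub_eq_zero, ← map_sub]
    exact hL _ (Submodule.le_topologicalClosure _ (Submodule.subset_span ⟨y, rfl⟩))
  have h1 : ∀ k, L (averagedTranslate (ε k) f) = L f := fun k => by
    rw [map_averagedTranslate hf.uniformContinuous]
    simp [hinv, volume_real_cube]
  have h2 := h L
  simp only [h1] at h2
  rw [map_sub, sub_eq_zero]
  exact tendsto_nhds_unique tendsto_const_nhds h2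

theorem tendsto_scaledIntegral_of_mem_topologicalClosure
    (ν : Measure (EuclideanSpace ℝ (Fin n))) [IsFiniteMeasure ν] {S : Submodule ℝ (Cb n)}
    (hS : ∀ h ∈ S, Tendsto (fun ε => scaledIntegral ν ε h) (𝓝[>] 0) (𝓝 0)) {h : Cb n}
    (hh : h ∈ S.topologicalClosure) :
    Tendsto (fun ε => scaledIntegral ν ε h) (𝓝[>] 0) (𝓝 0) := by
  obtain ⟨u, hu, hlim⟩ := mem_closure_iff_seq_limit.1 hh
  refine TendstoUniformlyOnFilter.tendsto_of_eventually_tendsto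
    (F := fun k ε => scaledIntegral ν ε (u k)) (p := atTop) (L := fun _ => (0 : ℝ)) ?_
    (Eventually.of_forall fun k => hS _ (hu k)) tendsto_const_nhds
  rw [Metric.tendstoUniformlyOnFilter_iff]
  intro r hr
  have h1 : Tendsto (fun k => ν.real Set.univ * ‖h - u k‖) atTop (𝓝 0) := by
    simpa using ((tendsto_const_nhds (x := h)).sub hlim).norm.const_mul (ν.real Set.univ)
  refine ((h1.eventually_lt_const hr).prod_mk (eventually_true _)).mono ?_
  rintro ⟨k, ε⟩ ⟨hk, -⟩
  rw [dist_eq_norm, ← map_sub]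
  exact ((scaledIntegral ν ε).le_of_opNorm_le (norm_scaledIntegral_le ν ε) _).trans_lt hk

theorem IsWeaklyAlmostPeriodic.exists_hasMeanValue {f : Cb n} (hf : IsWeaklyAlmostPeriodic f) :
    ∃ m : ℝ, HasMeanValue f m := by
  obtain ⟨c, hc⟩ := hf.exists_sub_const_mem
  refine ⟨c, f.continuous.locallyIntegrable, fun A hA hb => ?_⟩
  have := isFiniteMeasure_restrict_of_isBounded hb
  have key := tendsto_scaledIntegral_of_mem_topologicalClosure (volume.restrict A) (fun h hh => by
    induction hh using Submodule.span_induction with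
    | mem h hh =>
      obtain ⟨y, rfl⟩ := hh
      simp only [map_sub]
      exact tendsto_setIntegral_translate_sub hA hb f y
    | zero => simp
    | add h₁ h₂ _ _ ih₁ ih₂ => simpa using ih₁.add ih₂
    | smul a h _ ih => simpa using ih.const_mul a) hc
  have h2 : Tendsto (fun ε => scaledIntegral (volume.restrict A) ε f - volume.real A * c)
      (𝓝[>] 0) (𝓝 0) := by
    refine key.congr fun ε => ?_
    rw [map_sub]
    simp [scaledIntegral_apply]
  simpa [scaledIntegral_apply] using h2.add_const (volume.real A * c)

/-! ### Invariant means and ergodicity. -/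

theorem HasMeanValue.tendsto_cubeAverage {f : Cb n} {m : ℝ} (h : HasMeanValue f m) :
    Tendsto (fun ε => cubeAverage n ε f) (𝓝[>] 0) (𝓝 m) := by
  have := (h.2 (cube n) (isClosed_cube n).measurableSet.nullMeasurableSet
    (isBounded_cube n)).const_mul ((2 : ℝ) ^ n)⁻¹
  rwa [volume_real_cube, inv_mul_cancel_left₀ (by positivity)] at this

/-- A bounded sequence of functionals converges pointwise along an ultrafilter. -/
theorem exists_tendsto_hyperfilter {V : Type*} [NormedAddCommGroup V] [NormedSpace ℝ V]
    (α : ℕ → V →L[ℝ] ℝ) {C : ℝ} (hα : ∀ k v, ‖α k v‖ ≤ C * ‖v‖) :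
    ∃ L : V →L[ℝ] ℝ, ∀ v, Tendsto (fun k => α k v) (hyperfilter ℕ) (𝓝 (L v)) := by
  have h : ∀ v, ∃ x, ‖x‖ ≤ C * ‖v‖ ∧ Tendsto (fun k => α k v) (hyperfilter ℕ) (𝓝 x) := by
    intro v
    obtain ⟨x, hx, hlim⟩ := (isCompact_closedBall (0 : ℝ) (C * ‖v‖)).ultrafilter_le_nhds'
      ((hyperfilter ℕ).map fun k => α k v)
      (Filter.Eventually.of_forall (f := (hyperfilter ℕ : Filter ℕ))
        fun k => mem_closedBall_zero_iff.2 (hα k v))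
    exact ⟨x, mem_closedBall_zero_iff.1 hx, hlim⟩
  choose L hL hlim using h
  refine ⟨LinearMap.mkContinuous
    { toFun := L
      map_add' := fun v w => tendsto_nhds_unique (hlim (v + w)) ?_
      map_smul' := fun c v => tendsto_nhds_unique (hlim (c • v)) ?_ } C hL, hlim⟩
  · simpa only [map_add] using (hlim v).add (hlim w)
  · simpa only [map_smul, RingHom.id_apply] using (hlim v).const_smul c

theorem setOf_forall_mem_Icc_eq_smul_cube {L : ℝ} (hL : 0 < L) :
    {x : EuclideanSpace ℝ (Fin n) | ∀ i, x i ∈ Set.Icc (-L) L} = L • cube n := by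
  ext x
  rw [Set.mem_smul_set_iff_inv_smul_mem₀ hL.ne']
  refine forall_congr' fun i => ?_
  rw [PiLp.smul_apply, smul_eq_mul, Set.mem_Icc, Set.mem_Icc, le_inv_mul_iff₀ hL,
    inv_mul_le_iff₀ hL, mul_neg_one, mul_one]

theorem cubeAverage_inv (f : Cb n) {L : ℝ} (hL : 0 < L) :
    cubeAverage n L⁻¹ f = ((2 * L) ^ n)⁻¹ *
      ∫ x in {x : EuclideanSpace ℝ (Fin n) | ∀ i, x i ∈ Set.Icc (-L) L}, f x := by
  rw [cubeAverage_apply, inv_inv, Measure.setIntegral_comp_smul_of_pos volume (fun x => f x) _ hL,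
    setOf_forall_mem_Icc_eq_smul_cube hL, smul_eq_mul, ← mul_assoc, finrank_euclideanSpace_fin,
    mul_pow, mul_inv]

/-- A translation invariant mean on `C_b(ℝⁿ)` that extends the mean value. -/
structure IsInvariantMean (M : Cb n →L[ℝ] ℝ) : Prop where
  nonneg : ∀ f : Cb n, (∀ x, 0 ≤ f x) → 0 ≤ M f
  const : ∀ c, M (BoundedContinuousFunction.const _ c) = c
  translate : ∀ y (f : Cb n), M (translate y f) = M f
  hasMeanValue : ∀ (f : Cb n) m, HasMeanValue f m → M f = m

/-- An ultrafilter limit of cube averages is defined on all of `Cb n`, with no separability needed.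
-/
theorem exists_isInvariantMean (n : ℕ) : ∃ M : Cb n →L[ℝ] ℝ, IsInvariantMean M := by
  obtain ⟨M, hM⟩ := exists_tendsto_hyperfilter
    (fun k : ℕ => cubeAverage n (1 / ((k : ℝ) + 1)))
    fun k g => (cubeAverage n (1 / ((k : ℝ) + 1))).le_of_opNorm_le (norm_cubeAverage_le _) g
  have hδ : Tendsto (fun k : ℕ => 1 / ((k : ℝ) + 1)) (hyperfilter ℕ) (𝓝[>] 0) :=
    tendsto_one_div_add_atTop_nhdsGT_zero_nat.mono_left Nat.hyperfilter_le_atTop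
  refine ⟨M, fun f hf => ge_of_tendsto (hM f) (Eventually.of_forall fun k => ?_), fun c => ?_,
    fun y f => ?_, fun f m h => tendsto_nhds_unique (hM f) (h.tendsto_cubeAverage.comp hδ)⟩
  · rw [cubeAverage_apply]
    have : 0 ≤ ∫ x in cube n, f ((1 / ((k : ℝ) + 1))⁻¹ • x) := integral_nonneg fun x => hf _
    positivity
  · refine tendsto_nhds_unique (hM _) ?_
    simp [cubeAverage_const]
  · exact sub_eq_zero.1 (tendsto_nhds_unique ((hM _).sub (hM f))
      ((tendsto_cubeAverage_translate_sub f y).comp hδ))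

namespace IsInvariantMean

variable {M : Cb n →L[ℝ] ℝ}

theorem mul_self_nonneg (hM : IsInvariantMean M) (f : Cb n) : 0 ≤ M (f * f) :=
  hM.nonneg _ fun x => _root_.mul_self_nonneg (f x)

theorem mono (hM : IsInvariantMean M) {f g : Cb n} (h : ∀ x, f x ≤ g x) : M f ≤ M g := by
  have := hM.nonneg (g - f) fun x => sub_nonneg.2 (h x)
  rw [map_sub] at this
  linarith

theorem mul_const (f : Cb n) (c : ℝ) : M (f * BoundedContinuousFunction.const _ c) = c * M f := by
  rw [← smul_eq_mul c, ← map_smul]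
  congr 1
  ext x
  simp [mul_comm]

theorem sub_const_mul_self (hM : IsInvariantMean M) (f : Cb n) (c : ℝ) :
    M ((f - BoundedContinuousFunction.const _ c) * (f - BoundedContinuousFunction.const _ c)) =
      M (f * f) - 2 * c * M f + c ^ 2 := by
  have : (f - BoundedContinuousFunction.const _ c) * (f - BoundedContinuousFunction.const _ c) =
      f * f - (2 * c) • f + BoundedContinuousFunction.const _ (c ^ 2) := by
    ext x
    simp
    ring
  rw [this, map_add, map_sub, map_smul, hM.const, smul_eq_mul]

theorem sq_le (hM : IsInvariantMean M) (f : Cb n) : M f ^ 2 ≤ M (f * f) := by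
  have := hM.mul_self_nonneg (f - BoundedContinuousFunction.const _ (M f))
  rw [hM.sub_const_mul_self] at this
  nlinarith

theorem add_mul_self_le (hM : IsInvariantMean M) (f g h : Cb n) :
    M ((f + g + h) * (f + g + h)) ≤ 3 * (M (f * f) + M (g * g) + M (h * h)) := by
  have : 3 * (M (f * f) + M (g * g) + M (h * h)) = M ((3 : ℝ) • (f * f + g * g + h * h)) := by
    simp
    ring
  rw [this]
  refine hM.mono fun x => ?_
  change (f x + g x + h x) * (f x + g x + h x) ≤ 3 * (f x * f x + g x * g x + h x * h x)
  nlinarith [sq_nonneg (f x - g x), sq_nonneg (g x - h x), sq_nonneg (f x - h x)]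

theorem translate_sub_mul_self (hM : IsInvariantMean M) (f : Cb n)
    (y : EuclideanSpace ℝ (Fin n)) :
    M ((WAPAlgebra.translate y f - f) * (WAPAlgebra.translate y f - f)) =
      2 * M (f * f) - 2 * M (f * WAPAlgebra.translate y f) := by
  have : (WAPAlgebra.translate y f - f) * (WAPAlgebra.translate y f - f) =
      WAPAlgebra.translate y (f * f) + f * f - (2 : ℝ) • (f * WAPAlgebra.translate y f) := by
    ext x
    simp
    ring
  rw [this, map_sub, map_add, map_smul, hM.translate, smul_eq_mul]
  ring

/-- If all translates of `f` are close to `f` in quadratic mean, then so is the mean value. -/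
theorem sub_const_mul_self_le (hM : IsInvariantMean M) {f : Cb n}
    (hf : IsWeaklyAlmostPeriodic f) {δ : ℝ}
    (hδ : ∀ y, M ((WAPAlgebra.translate y f - f) * (WAPAlgebra.translate y f - f)) ≤ δ) :
    M ((f - BoundedContinuousFunction.const _ (M f)) *
      (f - BoundedContinuousFunction.const _ (M f))) ≤ δ := by
  obtain ⟨c, ε, hc⟩ := hf.exists_weaklyConvergesTo_const
  have havg : ∀ k, M (averagedTranslate (ε k) f) = M f := fun k => by
    rw [map_averagedTranslate hf.uniformContinuous]
    simp [hM.translate, volume_real_cube]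
  have hMc : M f = c := by
    have := hc M
    simp only [havg, hM.const] at this
    exact tendsto_nhds_unique tendsto_const_nhds this
  let Φ : Cb n →L[ℝ] ℝ := M.comp (ContinuousLinearMap.mul ℝ (Cb n) f)
  have hΦ : ∀ g, Φ g = M (f * g) := fun g => rfl
  have hlow : ∀ y, M (f * f) - δ / 2 ≤ Φ (WAPAlgebra.translate y f) := fun y => by
    have := hδ y
    rw [hM.translate_sub_mul_self] at this
    rw [hΦ]
    linarith
  have hlow' : ∀ k, M (f * f) - δ / 2 ≤ Φ (averagedTranslate (ε k) f) := by
    intro k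
    rw [map_averagedTranslate hf.uniformContinuous, le_inv_mul_iff₀ (by positivity),
      ← volume_real_cube, ← smul_eq_mul, ← setIntegral_const]
    have hcont : Continuous fun x : EuclideanSpace ℝ (Fin n) =>
        Φ (WAPAlgebra.translate ((ε k)⁻¹ • x) f) :=
      Φ.continuous.comp ((continuous_translate hf.uniformContinuous).comp (by fun_prop))
    exact setIntegral_mono (integrable_const _)
      (hcont.continuousOn.integrableOn_compact
        (Metric.isCompact_of_isClosed_isBounded (isClosed_cube n) (isBounded_cube n)))
      fun x => hlow _
  -- At the weak limit `c = M f` the bound reads `M (f * f) - δ / 2 ≤ c ^ 2`.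
  have hlim := ge_of_tendsto (hc Φ) (Eventually.of_forall hlow')
  rw [hΦ, mul_const, hMc] at hlim
  have hδ0 : 0 ≤ δ := (hM.mul_self_nonneg _).trans (hδ 0)
  rw [hM.sub_const_mul_self, hMc]
  nlinarith

/-- Since `f * f` is weakly almost periodic it has a mean value, so the upper limit is a limit. -/
theorem besicovitchSeminorm_eq (hM : IsInvariantMean M) {f : Cb n}
    (hf : IsWeaklyAlmostPeriodic f) :
    besicovitchSeminorm f = Real.sqrt (M (f * f)) := by
  obtain ⟨m, hm⟩ := (hf.mul hf).exists_hasMeanValue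
  rw [hM.hasMeanValue _ m hm, besicovitchSeminorm]
  congr 1
  refine Tendsto.limsup_eq ((hm.tendsto_cubeAverage.comp tendsto_inv_atTop_nhdsGT_zero).congr' ?_)
  filter_upwards [eventually_gt_atTop 0] with L hL
  rw [Function.comp_apply, cubeAverage_inv _ hL]
  simp only [sq_abs, pow_two (f _), mul_apply]

end IsInvariantMean

theorem isEquivConst_of_isInvariant (F : BesicovitchSpace (WAP n)) (hF : F.IsInvariant) :
    F.IsEquivConst := by
  obtain ⟨M, hM⟩ := exists_isInvariantMean n
  have hseq : ∀ k, IsWeaklyAlmostPeriodic (F.seq k) := F.seq_mem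
  have hsub : ∀ {f g : Cb n}, IsWeaklyAlmostPeriodic f → IsWeaklyAlmostPeriodic g →
      IsWeaklyAlmostPeriodic (f - g) := fun hf hg => (WAP n).sub_mem hf hg
  have hcauchy : ∀ ε > 0, ∃ N, ∀ j ≥ N, ∀ k ≥ N,
      M ((F.seq j - F.seq k) * (F.seq j - F.seq k)) < ε := by
    intro ε hε
    obtain ⟨N, hN⟩ := F.cauchy (Real.sqrt ε) (Real.sqrt_pos.2 hε)
    refine ⟨N, fun j hj k hk => ?_⟩
    have := hN j hj k hk
    rwa [hM.besicovitchSeminorm_eq (hsub (hseq j) (hseq k)),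
      Real.sqrt_lt_sqrt_iff (hM.mul_self_nonneg _)] at this
  have hinv : ∀ y, Tendsto (fun k => M ((translate y (F.seq k) - F.seq k) *
      (translate y (F.seq k) - F.seq k))) atTop (𝓝 0) := by
    intro y
    have := (hF y).pow 2
    simpa only [hM.besicovitchSeminorm_eq (hsub ((hseq _).translate y) (hseq _)),
      Real.sq_sqrt (hM.mul_self_nonneg _), zero_pow two_ne_zero] using this
  have hconst : Tendsto (fun k => M ((F.seq k - .const _ (M (F.seq k))) *
      (F.seq k - .const _ (M (F.seq k))))) atTop (𝓝 0) := by
    rw [Metric.tendsto_atTop]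
    intro ε hε
    -- With `k ≥ N` fixed and `j → ∞`, the three-term estimate tends to `3 (ε/12 + 0 + ε/12) = ε/2`,
    -- uniformly in `y`.
    obtain ⟨N, hN⟩ := hcauchy (ε / 12) (by positivity)
    refine ⟨N, fun k hk => ?_⟩
    rw [Real.dist_0_eq_abs, abs_of_nonneg (hM.mul_self_nonneg _)]
    refine (hM.sub_const_mul_self_le (hseq k) (δ := ε / 2) fun y => ?_).trans_lt (half_lt_self hε)
    have hlim : Tendsto (fun j => 3 * (ε / 12 + M ((translate y (F.seq j) - F.seq j) *
        (translate y (F.seq j) - F.seq j)) + ε / 12)) atTop (𝓝 (3 * (ε / 12 + 0 + ε / 12))) :=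
      (((hinv y).const_add _).add_const _).const_mul 3
    rw [show 3 * (ε / 12 + 0 + ε / 12) = ε / 2 by ring] at hlim
    refine ge_of_tendsto hlim ?_
    filter_upwards [eventually_ge_atTop N] with j hj
    have h1 : translate y (F.seq k) - F.seq k = translate y (F.seq k - F.seq j) +
        (translate y (F.seq j) - F.seq j) + (F.seq j - F.seq k) := by
      rw [translate_sub]
      abel
    rw [h1]
    refine (hM.add_mul_self_le _ _ _).trans ?_
    rw [← translate_mul, hM.translate]
    gcongr
    · exact (hN k hk j hj).le
    · exact (hN j hj k hk).le
  have hc : CauchySeq fun k => M (F.seq k) := by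
    rw [Metric.cauchySeq_iff]
    intro ε hε
    obtain ⟨N, hN⟩ := hcauchy (ε ^ 2) (by positivity)
    refine ⟨N, fun j hj k hk => ?_⟩
    rw [Real.dist_eq, ← map_sub]
    exact abs_lt_of_sq_lt_sq ((hM.sq_le _).trans_lt (hN j hj k hk)) hε.le
  obtain ⟨c, hc⟩ := cauchySeq_tendsto_of_complete hc
  refine ⟨c, ?_⟩
  have hlim : Tendsto (fun k => M ((F.seq k - .const _ c) * (F.seq k - .const _ c)))
      atTop (𝓝 0) := by
    have h1 : ∀ k, M ((F.seq k - .const _ c) * (F.seq k - .const _ c)) =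
        M ((F.seq k - .const _ (M (F.seq k))) * (F.seq k - .const _ (M (F.seq k)))) +
          (M (F.seq k) - c) ^ 2 := fun k => by
      rw [hM.sub_const_mul_self, hM.sub_const_mul_self]
      ring
    simp only [h1]
    simpa using hconst.add ((hc.sub_const c).pow 2)
  have h2 := (Real.continuous_sqrt.tendsto 0).comp hlim
  rw [Real.sqrt_zero] at h2
  exact h2.congr fun k =>
    (hM.besicovitchSeminorm_eq (hsub (hseq k) (isWeaklyAlmostPeriodic_const c))).symm

theorem isErgodicAlgebra_WAP (n : ℕ) : IsErgodicAlgebra (WAP n) where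
  subset_buc _ hf := IsWeaklyAlmostPeriodic.uniformContinuous hf
  mul_mem _ hf _ hg := IsWeaklyAlmostPeriodic.mul hf hg
  translate_mem _ hf y := IsWeaklyAlmostPeriodic.translate hf y
  exists_meanValue _ hf := IsWeaklyAlmostPeriodic.exists_hasMeanValue hf
  isClosed := isClosed_WAP
  one_mem := isWeaklyAlmostPeriodic_const 1
  ergodic := isEquivConst_of_isInvariant

/-! ### Hilbert space compactness and Fourier–Stieltjes transforms. -/

/-- Bounded sequences in a Hilbert space have weakly convergent subsequences. -/
theorem exists_subseq_weaklyConverges {H : Type*} [NormedAddCommGroup H] [InnerProductSpace ℝ H]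
    [CompleteSpace H] (u : ℕ → H) {C : ℝ} (hu : ∀ k, ‖u k‖ ≤ C) :
    ∃ (φ : ℕ → ℕ) (w : H), StrictMono φ ∧
      ∀ L : H →L[ℝ] ℝ, Tendsto (fun k => L (u (φ k))) atTop (𝓝 (L w)) := by
  let E : Submodule ℝ H := (Submodule.span ℝ (Set.range u)).topologicalClosure
  have hsep : TopologicalSpace.IsSeparable (E : Set H) := by
    rw [Submodule.topologicalClosure_coe]
    exact (Set.countable_range u).isSeparable.span.closure
  have hmem : ∀ k, u k ∈ E := fun k =>
    Submodule.le_topologicalClosure _ (Submodule.subset_span ⟨k, rfl⟩)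
  obtain ⟨φ, Λ, hφ, hlim⟩ := exists_subseq_tendsto_functional hsep (fun k => innerSL ℝ (u k))
    ((norm_nonneg _).trans (hu 0)) fun k v => (norm_inner_le_norm (u k) v).trans
      (mul_le_mul_of_nonneg_right (hu k) (norm_nonneg v))
  let w := (InnerProductSpace.toDual ℝ H).symm Λ
  -- Convergence is known only against vectors of `E`; since `u k ∈ E`, any other vector may be
  -- replaced by its projection to `E`.
  refine ⟨φ, E.starProjection w, hφ, fun L => ?_⟩
  let z := (InnerProductSpace.toDual ℝ H).symm L
  have hL : ∀ v, L v = inner ℝ v z := fun v => by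
    rw [real_inner_comm, InnerProductSpace.toDual_symm_apply]
  have hu' : ∀ k, L (u k) = innerSL ℝ (u k) (E.starProjection z) := fun k => by
    rw [hL, innerSL_apply_apply, ← Submodule.inner_starProjection_left_eq_right,
      Submodule.starProjection_eq_self_iff.2 (hmem k)]
  have hw : L (E.starProjection w) = Λ (E.starProjection z) := by
    rw [hL, Submodule.inner_starProjection_left_eq_right, InnerProductSpace.toDual_symm_apply]
  rw [hw]
  simp only [hu']
  exact hlim _ (E.starProjection_apply_mem z)

section FourierStieltjes

/-- The character `y ↦ e^{i x·y}`. -/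
def character (x y : EuclideanSpace ℝ (Fin n)) : ℂ :=
  Complex.exp (Complex.I * (inner ℝ x y : ℝ))

theorem norm_character (x y : EuclideanSpace ℝ (Fin n)) : ‖character x y‖ = 1 := by
  rw [character, mul_comm, Complex.norm_exp_ofReal_mul_I]

theorem character_add (x z y : EuclideanSpace ℝ (Fin n)) :
    character (x + z) y = character z y * character x y := by
  simp only [character, inner_add_left, ← Complex.exp_add]
  congr 1
  push_cast
  ring

theorem continuous_character_left (y : EuclideanSpace ℝ (Fin n)) :
    Continuous fun x => character x y := by
  unfold character
  fun_prop

theorem continuous_character (x : EuclideanSpace ℝ (Fin n)) : Continuous (character x) := by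
  unfold character
  fun_prop

variable (μ : ComplexMeasure (EuclideanSpace ℝ (Fin n))) [IsFiniteMeasure μ.variation]

theorem integrable_mul_character (ψ : Lp ℂ 2 μ.variation) (x : EuclideanSpace ℝ (Fin n)) :
    Integrable (fun y => ψ y * character x y) μ.variation :=
  ((Lp.memLp ψ).integrable one_le_two).mul_bdd (c := 1)
    (continuous_character x).aestronglyMeasurable
    (Eventually.of_forall fun y => (norm_character x y).le)

/-- The real part of the Fourier–Stieltjes transform of `ψ μ`, at a point. -/
def transform (ψ : Lp ℂ 2 μ.variation) (x : EuclideanSpace ℝ (Fin n)) : ℝ :=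
  (μ.integral (fun y => ψ y * character x y) (ContinuousLinearMap.mul ℝ ℂ)).re

/-- Cauchy–Schwarz against the constant `1`, for the finite measure `|μ|`. -/
theorem integral_norm_le (ψ : Lp ℂ 2 μ.variation) :
    ∫ y, ‖ψ y‖ ∂μ.variation ≤ (μ.variation Set.univ ^ (1 / 2 : ℝ)).toReal * ‖ψ‖ := by
  have h := eLpNorm_le_eLpNorm_mul_rpow_measure_univ (one_le_two (α := ENNReal))
    (Lp.aestronglyMeasurable ψ)
  rw [integral_norm_eq_lintegral_enorm (Lp.aestronglyMeasurable ψ),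
    ← eLpNorm_one_eq_lintegral_enorm,
    Lp.norm_def, mul_comm, ← ENNReal.toReal_mul]
  refine ENNReal.toReal_mono (ENNReal.mul_ne_top (Lp.eLpNorm_ne_top ψ) (by finiteness))
    (h.trans_eq ?_)
  norm_num

theorem abs_transform_le (ψ : Lp ℂ 2 μ.variation) (x : EuclideanSpace ℝ (Fin n)) :
    |transform μ ψ x| ≤ ‖ContinuousLinearMap.mul ℝ ℂ‖ *
      (μ.variation Set.univ ^ (1 / 2 : ℝ)).toReal * ‖ψ‖ := by
  refine (Complex.abs_re_le_norm _).trans (VectorMeasure.norm_integral_le_integral_norm.trans ?_)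
  rw [mul_assoc]
  gcongr
  simpa [norm_character] using integral_norm_le μ ψ

theorem continuous_transform (ψ : Lp ℂ 2 μ.variation) : Continuous (transform μ ψ) := by
  refine Complex.continuous_re.comp (VectorMeasure.continuous_of_dominated
    (bound := fun y => ‖ψ y‖) (fun x => (integrable_mul_character μ ψ x).aestronglyMeasurable)
    (fun x => Eventually.of_forall fun y => ?_)
    ((Lp.memLp ψ).integrable one_le_two).norm
    (Eventually.of_forall fun y => continuous_const.mul (continuous_character_left y)))
  simp [norm_character]

/-- The real part of the Fourier–Stieltjes transform of `ψ μ`, as a bounded operator on `L²`. -/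
def transformCLM : Lp ℂ 2 μ.variation →L[ℝ] Cb n :=
  LinearMap.mkContinuous
    { toFun := fun ψ => BoundedContinuousFunction.ofNormedAddCommGroup (transform μ ψ)
        (continuous_transform μ ψ) _ (abs_transform_le μ ψ)
      map_add' := fun ψ₁ ψ₂ => by
        ext x
        simp only [BoundedContinuousFunction.coe_ofNormedAddCommGroup, coe_add, Pi.add_apply]
        rw [transform, transform, transform, ← Complex.add_re, ← VectorMeasure.integral_fun_add
          (integrable_mul_character μ ψ₁ x) (integrable_mul_character μ ψ₂ x)]
        congr 1
        refine VectorMeasure.integral_congr_ae ?_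
        filter_upwards [Lp.coeFn_add ψ₁ ψ₂] with y hy
        rw [hy, Pi.add_apply, add_mul]
      map_smul' := fun c ψ => by
        ext x
        simp only [BoundedContinuousFunction.coe_ofNormedAddCommGroup, coe_smul, RingHom.id_apply]
        rw [transform, transform, ← Complex.smul_re, ← VectorMeasure.integral_fun_smul]
        congr 1
        refine VectorMeasure.integral_congr_ae ?_
        filter_upwards [Lp.coeFn_smul c ψ] with y hy
        rw [hy, Pi.smul_apply, smul_mul_assoc] }
    (‖ContinuousLinearMap.mul ℝ ℂ‖ * (μ.variation Set.univ ^ (1 / 2 : ℝ)).toReal)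
    fun ψ => (norm_le (by positivity)).2 (abs_transform_le μ ψ)

theorem memLp_character (x : EuclideanSpace ℝ (Fin n)) :
    MemLp (character x) 2 μ.variation :=
  MemLp.of_bound (continuous_character x).aestronglyMeasurable 1
    (Eventually.of_forall fun y => (norm_character x y).le)

theorem isWeaklyAlmostPeriodic_of_transform {f : Cb n} (hf : ∀ x, (f x : ℂ) =
      μ.integral (fun y => character x y) (ContinuousLinearMap.mul ℝ ℂ)) :
    IsWeaklyAlmostPeriodic f := by
  -- Translation by `z` multiplies the measure by the character of `z`, and these characters form a
  -- bounded set in `L²(|μ|)`.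
  have htr : ∀ z, translate z f = transformCLM μ ((memLp_character μ z).toLp _) := by
    intro z
    ext x
    change f (x + z) = transform μ _ x
    rw [← Complex.ofReal_re (f (x + z)), hf, transform]
    congr 1
    refine VectorMeasure.integral_congr_ae ?_
    filter_upwards [(memLp_character μ z).coeFn_toLp] with y hy
    rw [hy, character_add]
  intro z
  obtain ⟨φ, w, hφ, hw⟩ := exists_subseq_weaklyConverges
    (fun k => (memLp_character μ (z k)).toLp _) (C := _)
    fun k => Lp.norm_le_of_ae_bound zero_le_one (by
      filter_upwards [(memLp_character μ (z k)).coeFn_toLp] with y hy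
      rw [hy, norm_character])
  refine ⟨φ, hφ, transformCLM μ w, fun Λ => ?_⟩
  simp only [htr]
  exact hw (Λ.comp (transformCLM μ))

end FourierStieltjes

theorem FS_subset_WAP (n : ℕ) : FS n ⊆ (WAP n : Set (Cb n)) :=
  closure_minimal (fun _ ⟨μ, _, h⟩ => isWeaklyAlmostPeriodic_of_transform μ h) isClosed_WAP

end WAPAlgebra

end

theorem lemma2 (n : ℕ) :
    WAPAlgebra.IsErgodicAlgebra (WAPAlgebra.WAP n) ∧
      WAPAlgebra.FS n ⊆ (WAPAlgebra.WAP n : Set (WAPAlgebra.Cb n)) :=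
  ⟨WAPAlgebra.isErgodicAlgebra_WAP n, WAPAlgebra.FS_subset_WAP n⟩
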